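/- A finite relational structure $\mathbb A=(A;R_1,\dots,R_n)$ consists of a finite set $A$ and finitely many relations $R_i\subseteq A^{\mathrm{ar}(R_i)}$ with $\mathrm{ar}(R_i)\in\{0,1,2,\dots\}$. A polymorphism of $\mathbb A$ is a function $f:A^k\to A$, $k\in\{0,1,2,\dots\}$, such that for every $i$ and all $\mathbf r_1,\dots,\mathbf r_k\in R_i$ the tuple $f(\mathbf r_1,\dots,\mathbf r_k)$, with $f$ applied component-wise, is in $R_i$ (so a nullary polymorphism is an element $a\in A$ with $(a,\dots,a)\in R_i$ for all $i$). $\mathrm{Pol}(\mathbb A)$ denotes the set of all polymorphisms of $\mathbb A$. A strong Maltsev condition over a set $\Sigma$ of function symbols of finite arity (nullary symbols allowed) is a finite set of equations $t=s$ between terms built from variables and symbols in $\Sigma$; it is satisfied in a set $\mathcal M$ of functions on a common domain if the symbols of $\Sigma$ can be interpreted by members of $\mathcal M$ of the corresponding arities so that each equation holds for every choice of values of the variables. $\mathrm{CSP}(\mathbb A)$ is the problem of deciding whether a given primitive positive sentence over $\mathbb A$ (an existentially quantified finite conjunction of atomic formulas $R_i(x_{j_1},x_{j_2},\dots)$ and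 $x_j=x_k$) is true in $\mathbb A$. **Theorem.** Let $\mathbb A$ and $\mathbb B$ be finite relational structures. 1. If each strong Maltsev condition satisfied in $\mathrm{Pol}(\mathbb A)$ is satisfied in $\mathrm{Pol}(\mathbb B)$, then $\mathrm{CSP}(\mathbb B)$ is log-space many-one reducible to $\mathrm{CSP}(\mathbb A)$. 2. In particular, if $\mathrm{Pol}(\mathbb A)$ and $\mathrm{Pol}(\mathbb B)$ satisfy the same strong Maltsev conditions, then $\mathrm{CSP}(\mathbb A)$ and $\mathrm{CSP}(\mathbb B)$ have the same complexity, that is, each of them is log-space many-one reducible to the other. -/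

import Mathlib

/-! ### Relational structures, polymorphisms, strong Maltsev conditions -/

/-- A finite relational structure `(A; R₁, …, Rₙ)`: a finite domain with finitely many relations,
each of some arity in `ℕ`. -/
structure FinRelStr where
  Dom : Type*
  [finite_dom : Finite Dom]
  numRel : ℕ
  arity : Fin numRel → ℕ
  rel : ∀ i, Set (Fin (arity i) → Dom)

/-- The polymorphisms of `A`, sorted by arity: `f : Aᵏ → A` such that for all `r₁, …, rₖ ∈ Rᵢ` the
tuple obtained by applying `f` component-wise is in `Rᵢ`. The arity `k = 0` is included; a nullary
polymorphism is an element `a` with `(a, …, a) ∈ Rᵢ` for every `i`. -/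
def Pol (A : FinRelStr) (k : ℕ) : Set ((Fin k → A.Dom) → A.Dom) :=
  {f | ∀ i, ∀ r : Fin k → Fin (A.arity i) → A.Dom,
    (∀ j, r j ∈ A.rel i) → (fun p => f fun j => r j p) ∈ A.rel i}

/-- A strong Maltsev condition over a set of function symbols: a finite set of equations `t = s`
between terms built from variables (indexed by `ℕ`) and the function symbols. -/
structure StrongMaltsevCondition where
  lang : FirstOrder.Language.{0, 0}
  [isAlgebraic : lang.IsAlgebraic]
  eqs : Finset (lang.Term ℕ × lang.Term ℕ)

/-- `S` is satisfied in a set `M` of functions on `X` (sorted by arity): the symbols can be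
interpreted by members of `M` so that all equations hold for every choice of the variables. -/
def StrongMaltsevCondition.SatisfiedIn (S : StrongMaltsevCondition) {X : Type*}
    (M : ∀ k : ℕ, Set ((Fin k → X) → X)) : Prop :=
  ∃ I : S.lang.Structure X,
    (∀ (k : ℕ) (f : S.lang.Functions k), I.funMap f ∈ M k) ∧
    ∀ e ∈ S.eqs, ∀ v : ℕ → X, e.1.realize v = e.2.realize v

/-! ### Log-space many-one reductions

Deterministic Turing machines with a read-only two-way input tape, finitely many work tapes, and a
write-only one-way output tape. -/

/-- What the input head sees: a letter of the input, or one of the two end markers. -/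
inductive InputSymbol (Γ : Type) : Type
  | leftEnd
  | rightEnd
  | letter (a : Γ)

/-- Head movements. -/
inductive HeadMove : Type
  | left
  | stay
  | right

/-- A deterministic Turing transducer with input alphabet `Γ` and output alphabet `Δ`. In one step,
depending on the state, the scanned input symbol and the scanned symbols on the work tapes, it
either halts (`none`) or changes its state, moves the input head, writes a symbol and moves the head
on each work tape, and possibly appends one letter to the output. -/
structure Transducer (Γ Δ : Type) where
  State : Type
  [finite_state : Finite State]
  start : State
  numTapes : ℕ
  WorkSymbol : Type
  [finite_workSymbol : Finite WorkSymbol]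
  blank : WorkSymbol
  trans : State → InputSymbol Γ → (Fin numTapes → WorkSymbol) →
    Option (State × HeadMove × (Fin numTapes → WorkSymbol × HeadMove) × Option Δ)

namespace Transducer

variable {Γ Δ : Type}

/-- A configuration: state, position of the input head, contents of the (one-way infinite) work
tapes, positions of the work heads, and the output written so far. -/
structure Config (M : Transducer Γ Δ) where
  state : M.State
  inputPos : ℕ
  tape : Fin M.numTapes → ℕ → M.WorkSymbol
  workPos : Fin M.numTapes → ℕ
  output : List Δ

/-- The initial configuration: all heads at position `0`, blank work tapes, empty output. -/
def init (M : Transducer Γ Δ) : M.Config where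
  state := M.start
  inputPos := 0
  tape := fun _ _ => M.blank
  workPos := fun _ => 0
  output := []

/-- The symbol at position `p` of the input tape: position `0` carries the left end marker,
positions `1, …, |w|` the letters of `w`, and position `|w| + 1` the right end marker. -/
def scan (w : List Γ) : ℕ → InputSymbol Γ
  | 0 => .leftEnd
  | p + 1 => match w[p]? with
    | some a => .letter a
    | none => .rightEnd

/-- Moving a head on a one-way infinite tape; at position `0` a left move has no effect. -/
def moveHead : HeadMove → ℕ → ℕ
  | .left, p => p - 1
  | .stay, p => p
  | .right, p => p + 1

/-- One step of the computation on input `w`; `none` if the machine halts. The input head never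
leaves the positions `0, …, |w| + 1`. -/
def step (M : Transducer Γ Δ) (w : List Γ) (c : M.Config) : Option M.Config :=
  (M.trans c.state (scan w c.inputPos) fun i => c.tape i (c.workPos i)).map
    fun (q, d, a, o) =>
      { state := q
        inputPos := min (moveHead d c.inputPos) (w.length + 1)
        tape := fun i => Function.update (c.tape i) (c.workPos i) (a i).1
        workPos := fun i => moveHead (a i).2 (c.workPos i)
        output := c.output ++ o.toList }

/-- `M` halts on input `w` with output `u`. -/
def HaltsWith (M : Transducer Γ Δ) (w : List Γ) (u : List Δ) : Prop :=
  ∃ c, StateTransition.Reaches (M.step w) M.init c ∧ M.step w c = none ∧ c.output = u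

/-- In the computation of `M` on input `w` only the first `s` cells of each work tape are
visited. -/
def UsesSpace (M : Transducer Γ Δ) (w : List Γ) (s : ℕ) : Prop :=
  ∀ c, StateTransition.Reaches (M.step w) M.init c → ∀ i, c.workPos i < s

end Transducer

/-- A decision problem: instances, an injective encoding of them by words over a finite alphabet,
and the set of yes-instances. -/
structure DecisionProblem where
  Instance : Type
  Letter : Type
  [finite_letter : Finite Letter]
  encode : Instance → List Letter
  encode_injective : Function.Injective encode
  Yes : Instance → Prop

/-- `P` is log-space (many-one) reducible to `Q`: there is a map from the instances of `P` to the
instances of `Q` that preserves the answer and is computed by a Turing transducer visiting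
`O(log n)` work tape cells on encodings of length `n`. -/
def LogSpaceReducible (P Q : DecisionProblem) : Prop :=
  ∃ f : P.Instance → Q.Instance,
    (∃ (M : Transducer P.Letter Q.Letter) (C : ℕ), ∀ x : P.Instance,
      M.HaltsWith (P.encode x) (Q.encode (f x)) ∧
      M.UsesSpace (P.encode x) (C * (Nat.log 2 (P.encode x).length + 1))) ∧
    ∀ x : P.Instance, P.Yes x ↔ Q.Yes (f x)

/-! ### Primitive positive sentences and the CSP -/

/-- Atomic formulas with variables in `V` over relation symbols `R₁, …, Rₙ` of given arities, and
equality. -/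
inductive PPAtom {n : ℕ} (ar : Fin n → ℕ) (V : Type) : Type
  | rel (i : Fin n) (x : Fin (ar i) → V)
  | eq (x y : V)

/-- A primitive positive sentence in prenex normal form: a list of existentially quantified
variables `x_m` (given by their indices `m`), and a list of atomic formulas in these variables, to
be read as a conjunction. -/
structure PPSentence {n : ℕ} (ar : Fin n → ℕ) where
  vars : List ℕ
  atoms : List (PPAtom ar {m : ℕ // m ∈ vars})

/-- An atomic formula holds in `A` under the assignment `g`. -/
def PPAtom.Holds (A : FinRelStr) {V : Type} (g : V → A.Dom) : PPAtom A.arity V → Prop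
  | .rel i x => (fun p => g (x p)) ∈ A.rel i
  | .eq x y => g x = g y

/-- A primitive positive sentence is true in `A`: it has a satisfying assignment. -/
def PPSentence.TrueIn (A : FinRelStr) (φ : PPSentence A.arity) : Prop :=
  ∃ g : {m : ℕ // m ∈ φ.vars} → A.Dom, ∀ a ∈ φ.atoms, a.Holds A g

/-- The alphabet in which primitive positive sentences are written. -/
inductive PPLetter (n : ℕ) : Type
  | ex
  | rel (i : Fin n)
  | eq
  | var
  | bit (b : Bool)

/-- The variable `x_m`, written as the letter `var` followed by the binary digits of `m`. -/
def encodeVar {n : ℕ} (m : ℕ) : List (PPLetter n) :=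
  .var :: (Nat.bits m).map .bit

/-- An atomic formula, written as its relation symbol followed by its arguments. -/
def PPAtom.encode {n : ℕ} {ar : Fin n → ℕ} {s : List ℕ} :
    PPAtom ar {m : ℕ // m ∈ s} → List (PPLetter n)
  | .rel i x => .rel i :: (List.ofFn x).flatMap fun y => encodeVar y.1
  | .eq x y => .eq :: (encodeVar x.1 ++ encodeVar y.1)

/-- A sentence, written as `∃ x ∃ y … R(x, y, …) S(z, …) …`. -/
def PPSentence.encode {n : ℕ} {ar : Fin n → ℕ} (φ : PPSentence ar) : List (PPLetter n) :=
  (φ.vars.flatMap fun m => .ex :: encodeVar m) ++ φ.atoms.flatMap PPAtom.encode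

theorem PPLetter.finite (n : ℕ) : Finite (PPLetter n) := by
  let F : (Fin n ⊕ Bool) ⊕ Fin 3 → PPLetter n
    | .inl (.inl i) => .rel i
    | .inl (.inr b) => .bit b
    | .inr 0 => .ex
    | .inr 1 => .eq
    | .inr 2 => .var
  refine Finite.of_surjective F ?_
  rintro (_ | i | _ | _ | b)
  exacts [⟨.inr 0, rfl⟩, ⟨.inl (.inl i), rfl⟩, ⟨.inr 1, rfl⟩, ⟨.inr 2, rfl⟩, ⟨.inl (.inr b), rfl⟩]

/-- A word that does not begin with a binary digit. -/
def PPLetter.NoBit {n : ℕ} (l : List (PPLetter n)) : Prop :=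
  ∀ b t, l ≠ .bit b :: t

theorem bits_append_inj {n : ℕ} : ∀ {u v : List Bool} {s t : List (PPLetter n)},
    PPLetter.NoBit s → PPLetter.NoBit t →
    u.map PPLetter.bit ++ s = v.map PPLetter.bit ++ t → u = v ∧ s = t
  | [], [], _, _, _, _, h => ⟨rfl, by simpa using h⟩
  | [], b :: v, _, _, hs, _, h => absurd (by simpa using h) (hs b _)
  | b :: u, [], _, _, _, ht, h => absurd (by simpa using h.symm) (ht b _)
  | a :: u, b :: v, _, _, hs, ht, h => by
    simp only [List.map_cons, List.cons_append, List.cons.injEq, PPLetter.bit.injEq] at h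
    obtain ⟨h1, h2⟩ := bits_append_inj hs ht h.2
    exact ⟨by rw [h.1, h1], h2⟩

theorem encodeVar_append_inj {n : ℕ} {a b : ℕ} {s t : List (PPLetter n)}
    (hs : PPLetter.NoBit s) (ht : PPLetter.NoBit t)
    (h : encodeVar a ++ s = encodeVar b ++ t) : a = b ∧ s = t := by
  simp only [encodeVar, List.cons_append, List.cons.injEq, true_and] at h
  obtain ⟨h1, h2⟩ := bits_append_inj hs ht h
  exact ⟨Nat.digits_inj_iff.1 (by rw [Nat.digits_two_eq_bits, Nat.digits_two_eq_bits, h1]), h2⟩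

theorem noBit_flatMap_encodeVar {n : ℕ} {α : Type} (g : α → ℕ) (l : List α)
    {s : List (PPLetter n)} (hs : PPLetter.NoBit s) :
    PPLetter.NoBit (l.flatMap (fun y => encodeVar (g y)) ++ s) := by
  cases l with
  | nil => simpa using hs
  | cons a l => intro b t; simp [encodeVar]

theorem flatMap_encodeVar_append_inj {n : ℕ} {α : Type} {g : α → ℕ}
    (hg : Function.Injective g) {s t : List (PPLetter n)}
    (hs : PPLetter.NoBit s) (ht : PPLetter.NoBit t) :
    ∀ {u v : List α}, u.length = v.length →
    u.flatMap (fun y => encodeVar (g y)) ++ s = v.flatMap (fun y => encodeVar (g y)) ++ t →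
    u = v ∧ s = t
  | [], [], _, h => ⟨rfl, by simpa using h⟩
  | [], _ :: _, hl, _ => by simp at hl
  | _ :: _, [], hl, _ => by simp at hl
  | a :: u, b :: v, hl, h => by
    simp only [List.flatMap_cons, List.append_assoc] at h
    obtain ⟨h1, h2⟩ := encodeVar_append_inj (noBit_flatMap_encodeVar g u hs)
      (noBit_flatMap_encodeVar g v ht) h
    obtain ⟨h3, h4⟩ := flatMap_encodeVar_append_inj hg hs ht (by simpa using hl) h2
    exact ⟨by rw [hg h1, h3], h4⟩

theorem noBit_atoms {n : ℕ} {ar : Fin n → ℕ} {s : List ℕ}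
    (l : List (PPAtom ar {m : ℕ // m ∈ s})) :
    PPLetter.NoBit (l.flatMap PPAtom.encode) := by
  intro b t
  cases l with
  | nil => simp
  | cons a l => cases a <;> simp [PPAtom.encode]

theorem PPAtom.encode_append_inj {n : ℕ} {ar : Fin n → ℕ} {s : List ℕ}
    {a b : PPAtom ar {m : ℕ // m ∈ s}} {u v : List (PPLetter n)}
    (hu : PPLetter.NoBit u) (hv : PPLetter.NoBit v)
    (h : a.encode ++ u = b.encode ++ v) : a = b ∧ u = v := by
  cases a with
  | rel i x =>
    cases b with
    | rel j y =>
      simp only [PPAtom.encode, List.cons_append, List.cons.injEq, PPLetter.rel.injEq] at h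
      obtain ⟨rfl, h⟩ := h
      obtain ⟨h1, h2⟩ := flatMap_encodeVar_append_inj Subtype.val_injective hu hv (by simp) h
      exact ⟨by rw [List.ofFn_injective h1], h2⟩
    | eq y y' => simp [PPAtom.encode] at h
  | eq x x' =>
    cases b with
    | rel j y => simp [PPAtom.encode] at h
    | eq y y' =>
      have h' : [x, x'].flatMap (fun y => encodeVar y.1) ++ u =
          [y, y'].flatMap (fun y => encodeVar y.1) ++ v := by
        simpa [PPAtom.encode] using h
      obtain ⟨h1, h2⟩ := flatMap_encodeVar_append_inj Subtype.val_injective hu hv (by simp) h'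
      simp only [List.cons.injEq, and_true] at h1
      exact ⟨by rw [h1.1, h1.2], h2⟩

theorem atoms_encode_injective {n : ℕ} {ar : Fin n → ℕ} {s : List ℕ} :
    ∀ {u v : List (PPAtom ar {m : ℕ // m ∈ s})},
    u.flatMap PPAtom.encode = v.flatMap PPAtom.encode → u = v
  | [], [], _ => rfl
  | [], b :: v, h => by cases b <;> simp [PPAtom.encode] at h
  | a :: u, [], h => by cases a <;> simp [PPAtom.encode] at h
  | a :: u, b :: v, h => by
    obtain ⟨h1, h2⟩ := PPAtom.encode_append_inj (noBit_atoms u) (noBit_atoms v) h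
    rw [h1, atoms_encode_injective h2]

theorem prefix_encode_inj {n : ℕ} {s t : List (PPLetter n)}
    (hs : PPLetter.NoBit s) (ht : PPLetter.NoBit t)
    (hs' : ∀ l, s ≠ .ex :: l) (ht' : ∀ l, t ≠ .ex :: l) :
    ∀ {u v : List ℕ}, u.flatMap (fun m => .ex :: encodeVar m) ++ s =
      v.flatMap (fun m => .ex :: encodeVar m) ++ t → u = v ∧ s = t
  | [], [], h => ⟨rfl, by simpa using h⟩
  | [], b :: v, h => absurd (by simpa using h) (hs' _)
  | a :: u, [], h => absurd (by simpa using h.symm) (ht' _)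
  | a :: u, b :: v, h => by
    have key : ∀ (l : List ℕ) {r : List (PPLetter n)}, PPLetter.NoBit r →
        PPLetter.NoBit (l.flatMap (fun m => .ex :: encodeVar m) ++ r) := by
      intro l r hr
      cases l with
      | nil => simpa using hr
      | cons a l => intro b t; simp
    simp only [List.flatMap_cons, List.cons_append, List.append_assoc, List.cons.injEq,
      true_and] at h
    obtain ⟨h1, h2⟩ := encodeVar_append_inj (key u hs) (key v ht) h
    obtain ⟨h3, h4⟩ := prefix_encode_inj hs ht hs' ht' h2
    exact ⟨by rw [h1, h3], h4⟩

theorem PPSentence.encode_injective {n : ℕ} (ar : Fin n → ℕ) :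
    Function.Injective (PPSentence.encode (ar := ar)) := by
  have key : ∀ {s : List ℕ} (l : List (PPAtom ar {m : ℕ // m ∈ s})) (t : List (PPLetter n)),
      l.flatMap PPAtom.encode ≠ .ex :: t := by
    intro s l t
    cases l with
    | nil => simp
    | cons a l => cases a <;> simp [PPAtom.encode]
  rintro ⟨x, a⟩ ⟨y, b⟩ h
  obtain ⟨rfl, h2⟩ := prefix_encode_inj (noBit_atoms a) (noBit_atoms b) (key a) (key b) h
  rw [atoms_encode_injective h2]

/-- The constraint satisfaction problem over the template `A`: given a primitive positive sentence
over `A`, decide whether it is true. -/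
def CSP (A : FinRelStr) : DecisionProblem where
  Instance := PPSentence A.arity
  Letter := PPLetter A.numRel
  finite_letter := PPLetter.finite A.numRel
  encode := PPSentence.encode
  encode_injective := PPSentence.encode_injective A.arity
  Yes := PPSentence.TrueIn A

/-! Let `φ` be a sentence over `B`. Every block of its encoding (a quantified variable, an equality,
a relational atom) has a constraint `C` on the values of its variables; for a quantified variable it
is all of `B`. Attach to each block `b` an operation symbol `f_b` whose arguments are indexed by the
tuples of `C`, and for each position `p` of `b`, carrying the variable `x`, impose the minor
equation `f_b (t ↦ v (t p)) = f_x v`. This is the strong Maltsev condition `minorCondition φ`.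

If `φ` is true in `B`, a satisfying assignment selects one tuple from each `C`, and the projections
to these tuples satisfy all equations, on any domain (`minorSentence_trueIn`). Conversely, suppose
that the condition holds in `Pol B`. Put `v = id`: as `f_b` preserves the relation of its block,
applying it to all tuples of `C` gives a tuple of `C`, whose entries are the values `f_x id` by the
equations. So `x ↦ f_x id` satisfies `φ`. Under the hypothesis it suffices that the condition holds
in `Pol A` (`trueIn_of_minorSentence_trueIn`).

The existence of such polymorphisms of `A` is itself a primitive positive sentence over `A`,
`minorSentence A φ`. Its variables are the entries of the tables of the `f_b`, its relational atoms
say that the `f_b` are polymorphisms, and its equalities are the minor equations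
(`minorSentence_trueIn_iff`). It therefore serves as the instance of `CSP A`.

The part contributed by a block depends only on its head and its variables, and for fixed `A` and
`B` its number of variables and atoms is bounded. With suitable names for the new variables, a
two-way finite transducer writes the sentence in two passes, one for quantifiers and one for atoms,
without any work tape (`BlockTransducer.haltsWith`, `encode_minorSentence`). -/

/-! ### Blocks of a primitive positive sentence -/

/-- The letters that open a block of the encoding of a sentence: a quantifier, the equality sign, or
a relation symbol. -/
inductive BlockHead (n : ℕ) : Type
  | ex
  | eq
  | rel (i : Fin n)

namespace BlockHead

variable {n : ℕ}

/-- The letter that writes a block head. -/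
def letter : BlockHead n → PPLetter n
  | ex => .ex
  | eq => .eq
  | rel i => .rel i

/-- The number of variables following a block head. -/
def arity (ar : Fin n → ℕ) : BlockHead n → ℕ
  | ex => 1
  | eq => 2
  | rel i => ar i

instance : Finite (BlockHead n) := by
  refine Finite.of_surjective
    (fun x : Fin n ⊕ Bool => x.elim BlockHead.rel fun b => if b then .ex else .eq) ?_
  rintro (_ | _ | i)
  exacts [⟨.inr true, rfl⟩, ⟨.inr false, rfl⟩, ⟨.inl i, rfl⟩]

/-- The constraint on the values of the variables in a block. -/
def constraint (B : FinRelStr) :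
    (h : BlockHead B.numRel) → Set (Fin (h.arity B.arity) → B.Dom)
  | ex => Set.univ
  | eq => {t : Fin 2 → B.Dom | t 0 = t 1}
  | rel i => B.rel i

end BlockHead

/-- A block of the encoding of a sentence: a head letter with the variables following it. -/
structure PPBlock {n : ℕ} (ar : Fin n → ℕ) where
  head : BlockHead n
  args : Fin (head.arity ar) → ℕ

namespace PPBlock

variable {n : ℕ} {ar : Fin n → ℕ}

/-- The word that writes a block. -/
def word (b : PPBlock ar) : List (PPLetter n) :=
  b.head.letter :: (List.ofFn b.args).flatMap encodeVar

/-- The block quantifying the variable `x_m`. -/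
def quantifier (m : ℕ) : PPBlock ar :=
  ⟨.ex, fun _ => m⟩

/-- The block of an atomic formula. -/
def ofAtom {s : List ℕ} : PPAtom ar {m : ℕ // m ∈ s} → PPBlock ar
  | .rel i x => ⟨.rel i, fun p => (x p).1⟩
  | .eq x y => ⟨.eq, ![x.1, y.1]⟩

theorem word_ofAtom {s : List ℕ} (a : PPAtom ar {m : ℕ // m ∈ s}) :
    (ofAtom a).word = a.encode := by
  cases a with
  | rel i x =>
    have h : List.ofFn (fun p => (x p).1) = (List.ofFn x).map Subtype.val := by
      rw [List.map_ofFn]; rfl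
    simp only [ofAtom, word, PPAtom.encode, BlockHead.letter]
    congr 1
    exact (congrArg (List.flatMap encodeVar) h).trans (List.flatMap_map _ _ _)
  | eq x y => simp [ofAtom, word, PPAtom.encode, BlockHead.letter, BlockHead.arity, List.ofFn_succ]

end PPBlock

namespace PPSentence

variable {n : ℕ} {ar : Fin n → ℕ}

/-- The blocks of a sentence. -/
def blocks (φ : PPSentence ar) : List (PPBlock ar) :=
  φ.vars.map PPBlock.quantifier ++ φ.atoms.map PPBlock.ofAtom

theorem encode_eq_flatMap_blocks (φ : PPSentence ar) :
    φ.encode = φ.blocks.flatMap PPBlock.word := by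
  simp only [encode, blocks, List.flatMap_append, List.flatMap_map, PPBlock.word_ofAtom]
  congr 1
  simp [PPBlock.quantifier, PPBlock.word, BlockHead.letter, BlockHead.arity]

theorem quantifier_mem_blocks {φ : PPSentence ar} {m : ℕ} (hm : m ∈ φ.vars) :
    PPBlock.quantifier m ∈ φ.blocks :=
  List.mem_append_left _ (List.mem_map_of_mem hm)

theorem args_mem_vars {φ : PPSentence ar} {b : PPBlock ar} (hb : b ∈ φ.blocks)
    (p : Fin (b.head.arity ar)) : b.args p ∈ φ.vars := by
  simp only [blocks, List.mem_append, List.mem_map] at hb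
  rcases hb with ⟨m, hm, rfl⟩ | ⟨a, -, rfl⟩
  · exact hm
  · cases a with
    | rel i x => exact (x p).2
    | eq x y =>
      change Fin 2 at p
      fin_cases p
      exacts [x.2, y.2]

end PPSentence

/-! ### Naming variables by tagged lists of numbers -/

/-- A self-delimiting binary code of a number. -/
def delimitedBits (m : ℕ) : List Bool :=
  (Nat.bits m).flatMap (fun b => [false, b]) ++ [true]

/-- The code is prefix-free: a flag `0` announces each digit, and the flag `1` ends the code. -/
theorem delimitedBits_append_inj {m k : ℕ} {s t : List Bool}
    (h : delimitedBits m ++ s = delimitedBits k ++ t) : m = k ∧ s = t := by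
  have key : ∀ {u v : List Bool},
      u.flatMap (fun b => [false, b]) ++ [true] ++ s =
        v.flatMap (fun b => [false, b]) ++ [true] ++ t → u = v ∧ s = t := by
    intro u
    induction u with
    | nil => rintro (_ | ⟨b, v⟩) h <;> simp_all
    | cons a u ih =>
      rintro (_ | ⟨b, v⟩) h
      · simp at h
      · simp only [List.flatMap_cons, List.cons_append, List.nil_append, List.cons.injEq,
          true_and, List.append_assoc] at h
        obtain ⟨h1, h2⟩ := ih (by simpa using h.2)
        exact ⟨by rw [h.1, h1], h2⟩
  obtain ⟨h1, h2⟩ := key h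
  exact ⟨Nat.digits_inj_iff.1 (by rw [Nat.digits_two_eq_bits, Nat.digits_two_eq_bits, h1]), h2⟩

theorem flatMap_delimitedBits_injective :
    Function.Injective fun l : List ℕ => l.flatMap delimitedBits := by
  intro u
  induction u with
  | nil => rintro (_ | ⟨b, v⟩) h <;> simp_all [delimitedBits]
  | cons a u ih =>
    rintro (_ | ⟨b, v⟩) h
    · simp [delimitedBits] at h
    · obtain ⟨h1, h2⟩ := delimitedBits_append_inj h
      rw [h1, ih h2]

/-- A binary code of a number (the tag, in unary) and a list of numbers; its last digit is `1`. -/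
def nameBits (k : ℕ) (l : List ℕ) : List Bool :=
  List.replicate k false ++ true :: l.flatMap delimitedBits

/-- The zeros before the first `1` count the tag; what follows is a concatenation of prefix-free
codes. -/
theorem nameBits_inj {k k' : ℕ} {l l' : List ℕ} (h : nameBits k l = nameBits k' l') :
    k = k' ∧ l = l' := by
  unfold nameBits at h
  induction k generalizing k' with
  | zero =>
    cases k' with
    | zero =>
      simp only [List.replicate_zero, List.nil_append, List.cons.injEq, true_and] at h
      exact ⟨rfl, flatMap_delimitedBits_injective h⟩
    | succ k' => simp [List.replicate_succ] at h
  | succ k ih =>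
    cases k' with
    | zero => simp [List.replicate_succ] at h
    | succ k' =>
      simp only [List.replicate_succ, List.cons_append, List.cons.injEq, true_and] at h
      obtain ⟨h1, h2⟩ := ih h
      exact ⟨by rw [h1], h2⟩

theorem exists_nameBits_eq_append (k : ℕ) (l : List ℕ) : ∃ u, nameBits k l = u ++ [true] := by
  rcases List.eq_nil_or_concat l with rfl | ⟨l, m, rfl⟩
  · exact ⟨List.replicate k false, by simp [nameBits]⟩
  · exact ⟨List.replicate k false ++ true :: (l.flatMap delimitedBits ++
      (Nat.bits m).flatMap fun b => [false, b]), by simp [nameBits, delimitedBits]⟩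

/-- `Nat.bits` starts with the least significant digit, so only a final `0` could prevent a nonempty
word from being a digit list. -/
theorem exists_bits_eq (u : List Bool) : ∃ m, Nat.bits m = u ++ [true] := by
  induction u with
  | nil => exact ⟨1, by simp⟩
  | cons b u ih =>
    obtain ⟨m, hm⟩ := ih
    refine ⟨Nat.bit b m, ?_⟩
    rw [Nat.bits_append_bit, hm, List.cons_append]
    rintro rfl
    simp at hm

/-- The number with binary digits `nameBits k l`. -/
noncomputable def name (k : ℕ) (l : List ℕ) : ℕ :=
  (exists_bits_eq (exists_nameBits_eq_append k l).choose).choose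

theorem bits_name (k : ℕ) (l : List ℕ) : Nat.bits (name k l) = nameBits k l := by
  rw [name, (exists_bits_eq _).choose_spec, ← (exists_nameBits_eq_append k l).choose_spec]

theorem name_inj {k k' : ℕ} {l l' : List ℕ} (h : name k l = name k' l') : k = k' ∧ l = l' :=
  nameBits_inj (by rw [← bits_name, h, bits_name])

/-! ### Transducers that rewrite a sentence block by block

Such a transducer makes two passes over the encoding of a sentence. In each pass it runs on every
block a program that depends only on the pass and on the head of the block. It has no work tapes. -/

/-- Commands that are run on a block: write a letter, or write the digits of the `p`-th variable of
the block, each of them preceded by the digit `0`. -/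
inductive BlockCommand (m : ℕ) : Type
  | emit (a : PPLetter m)
  | copyVar (p : ℕ)

namespace BlockCommand

variable {m : ℕ}

/-- The word written by a command on a block with variables `l`. -/
def eval (l : List ℕ) : BlockCommand m → List (PPLetter m)
  | emit a => [a]
  | copyVar p => (Nat.bits (l.getD p 0)).flatMap fun b => [.bit false, .bit b]

/-- The command only refers to the first `k` variables. -/
def Bounded (k : ℕ) : BlockCommand m → Prop
  | emit _ => True
  | copyVar p => p < k

end BlockCommand

/-- Elementary instructions: write a letter, move right to the next variable, or copy the digits of
the present variable and return to the head of the block. -/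
inductive BlockInstr (m : ℕ) : Type
  | emit (a : PPLetter m)
  | next
  | copy

/-- The instructions implementing a command. -/
def BlockCommand.compile {m : ℕ} : BlockCommand m → List (BlockInstr m)
  | emit a => [.emit a]
  | copyVar p => List.replicate (p + 1) .next ++ [.copy]

/-- The block head written by a letter. -/
def PPLetter.head? {n : ℕ} : PPLetter n → Option (BlockHead n)
  | ex => some .ex
  | eq => some .eq
  | rel i => some (.rel i)
  | var => none
  | bit _ => none

theorem PPLetter.head?_letter {n : ℕ} (h : BlockHead n) : h.letter.head? = some h := by
  cases h <;> rfl

theorem PPLetter.head?_of_mem_encodeVar {n : ℕ} {a : PPLetter n} {l : List ℕ}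
    (h : a ∈ l.flatMap encodeVar) : a.head? = none := by
  simp only [List.mem_flatMap, encodeVar, List.mem_cons, List.mem_map] at h
  obtain ⟨-, -, rfl | ⟨b, -, rfl⟩⟩ := h <;> rfl

namespace BlockTransducer

/-- What a block transducer is doing: looking for the next block, returning to the left end between
the two passes, running a program, looking for the next variable, copying a digit (in two steps), or
returning to the head of the block. -/
inductive Mode : Type
  | seek
  | rewind
  | run
  | next
  | copy
  | copyDigit
  | back

instance : Finite Mode :=
  Finite.of_surjective
    (fun i : Fin 7 => (![.seek, .rewind, .run, .next, .copy, .copyDigit, .back] i : Mode)) <| by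
    rintro (_ | _ | _ | _ | _ | _ | _)
    exacts [⟨0, rfl⟩, ⟨1, rfl⟩, ⟨2, rfl⟩, ⟨3, rfl⟩, ⟨4, rfl⟩, ⟨5, rfl⟩, ⟨6, rfl⟩]

variable {n m : ℕ} (prog : Bool → BlockHead n → List (BlockCommand m))

/-- What may be left to run of one of the programs. -/
def Remainder : Type :=
  {l : List (BlockInstr m) // ∃ pass h, l <:+ (prog pass h).flatMap BlockCommand.compile}

/-- Only suffixes of finitely many fixed instruction lists occur, so a program counter can be kept
in the state. -/
instance : Finite (Remainder prog) := by
  refine Set.Finite.to_subtype (s := {l | ∃ pass h, l <:+ _}) ?_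
  simp only [Set.ofPred_exists]
  refine Set.finite_iUnion fun pass => Set.finite_iUnion fun h => ?_
  simpa using List.finite_toSet ((prog pass h).flatMap BlockCommand.compile).tails

variable {prog}

/-- The remainder after one instruction. -/
def Remainder.pop (r : Remainder prog) : Remainder prog :=
  ⟨r.1.tail, let ⟨pass, h, hr⟩ := r.2; ⟨pass, h, (List.tail_suffix _).trans hr⟩⟩

variable (prog)

/-- The whole program to be run on a block. -/
def Remainder.load (pass : Bool) (h : BlockHead n) : Remainder prog :=
  ⟨(prog pass h).flatMap BlockCommand.compile, pass, h, List.suffix_rfl⟩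

/-- States: the pass (`false` for the first one), the mode, and the rest of the program. -/
abbrev State : Type := Bool × Mode × Remainder prog

/-- The transition function. -/
def next : State prog → InputSymbol (PPLetter n) →
    Option (State prog × HeadMove × Option (PPLetter m))
  | (pass, .seek, r), .leftEnd => some ((pass, .seek, r), .right, none)
  | (false, .seek, r), .rightEnd => some ((false, .rewind, r), .left, none)
  | (true, .seek, _), .rightEnd => none
  | (pass, .seek, r), .letter a =>
    match a.head? with
    | some h => some ((pass, .run, .load prog pass h), .stay, none)
    | none => some ((pass, .seek, r), .right, none)
  | (_, .rewind, r), .leftEnd => some ((true, .seek, r), .right, none)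
  | (pass, .rewind, r), _ => some ((pass, .rewind, r), .left, none)
  | (pass, .run, r), _ =>
    match r.1 with
    | [] => some ((pass, .seek, r), .right, none)
    | .emit a :: _ => some ((pass, .run, r.pop), .stay, some a)
    | .next :: _ => some ((pass, .next, r.pop), .right, none)
    | .copy :: _ => some ((pass, .copy, r.pop), .right, none)
  | (pass, .next, r), .letter .var => some ((pass, .run, r), .stay, none)
  | (pass, .next, r), _ => some ((pass, .next, r), .right, none)
  | (pass, .copy, r), .letter (.bit _) =>
    some ((pass, .copyDigit, r), .stay, some (.bit false))
  | (pass, .copy, r), _ => some ((pass, .back, r), .left, none)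
  | (pass, .copyDigit, r), .letter (.bit b) => some ((pass, .copy, r), .right, some (.bit b))
  | (_, .copyDigit, _), _ => none
  | (pass, .back, r), .letter a =>
    match a.head? with
    | some _ => some ((pass, .run, r), .stay, none)
    | none => some ((pass, .back, r), .left, none)
  | (_, .back, _), _ => none

/-- The transducer running `prog pass h` on every block with head `h` in the given pass. -/
def machine : Transducer (PPLetter n) (PPLetter m) where
  State := State prog
  start := (false, .seek, .load prog false .ex)
  numTapes := 0
  WorkSymbol := Unit
  blank := ()
  trans q s _ := (next prog q s).map fun x => (x.1, x.2.1, fun i => i.elim0, x.2.2)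

/-- The configuration with given state, position of the input head, and output. -/
def config (q : State prog) (pos : ℕ) (out : List (PPLetter m)) : (machine prog).Config where
  state := q
  inputPos := pos
  tape := fun i => i.elim0
  workPos := fun i => i.elim0
  output := out

/-- The configuration `c'` is reached from `c` on input `w`. -/
def Reaches (w : List (PPLetter n)) (c c' : (machine prog).Config) : Prop :=
  StateTransition.Reaches ((machine prog).step w) c c'

variable {prog} {w pre post : List (PPLetter n)} {out : List (PPLetter m)} {pass : Bool}

/-! ### Elementary moves of a block transducer -/

theorem init_eq : (machine prog).init = config prog (false, .seek, .load prog false .ex) 0 [] := by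
  unfold Transducer.init config
  congr 1
  all_goals exact funext fun i => i.elim0

theorem step_config {q q' : State prog} {pos : ℕ} {d : HeadMove} {o : Option (PPLetter m)}
    (h : next prog q (Transducer.scan w pos) = some (q', d, o)) :
    (machine prog).step w (config prog q pos out) =
      some (config prog q' (min (Transducer.moveHead d pos) (w.length + 1)) (out ++ o.toList)) := by
  simp only [Transducer.step, machine, config] at h ⊢
  rw [h]
  simp only [Option.map_some, Option.some.injEq, Transducer.Config.mk.injEq]
  exact ⟨trivial, trivial, funext fun i => i.elim0, funext fun i => i.elim0, trivial⟩

theorem Reaches.trans {c c' c'' : (machine prog).Config} (h : Reaches prog w c c')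
    (h' : Reaches prog w c' c'') : Reaches prog w c c'' :=
  Relation.ReflTransGen.trans h h'

theorem reaches_refl {c : (machine prog).Config} : Reaches prog w c c :=
  Relation.ReflTransGen.refl

theorem reaches_stay {q q' : State prog} {pos : ℕ} {o : Option (PPLetter m)}
    (hp : pos ≤ w.length + 1)
    (h : next prog q (Transducer.scan w pos) = some (q', .stay, o)) :
    Reaches prog w (config prog q pos out) (config prog q' pos (out ++ o.toList)) := by
  refine Relation.ReflTransGen.single ?_
  rw [step_config h, Transducer.moveHead, min_eq_left hp]
  rfl

theorem reaches_right {q q' : State prog} {pos : ℕ} {o : Option (PPLetter m)}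
    (hp : pos ≤ w.length)
    (h : next prog q (Transducer.scan w pos) = some (q', .right, o)) :
    Reaches prog w (config prog q pos out) (config prog q' (pos + 1) (out ++ o.toList)) := by
  refine Relation.ReflTransGen.single ?_
  rw [step_config h, Transducer.moveHead, min_eq_left (by omega)]
  rfl

theorem reaches_left {q q' : State prog} {pos : ℕ} {o : Option (PPLetter m)}
    (hp : pos ≤ w.length)
    (h : next prog q (Transducer.scan w (pos + 1)) = some (q', .left, o)) :
    Reaches prog w (config prog q (pos + 1) out) (config prog q' pos (out ++ o.toList)) := by
  refine Relation.ReflTransGen.single ?_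
  rw [step_config h, Transducer.moveHead, min_eq_left (by omega)]
  rfl

theorem scan_append (a : PPLetter n) :
    Transducer.scan (pre ++ a :: post) (pre.length + 1) = .letter a := by
  simp [Transducer.scan]

theorem scan_end : Transducer.scan w (w.length + 1) = .rightEnd := by
  simp [Transducer.scan]

theorem scan_noBit (hpost : PPLetter.NoBit post) (b : Bool) :
    Transducer.scan (pre ++ post) (pre.length + 1) ≠ .letter (.bit b) := by
  cases post with
  | nil => simp [Transducer.scan]
  | cons a t =>
    rw [scan_append]
    rintro ⟨⟩
    exact hpost b t rfl

theorem walk_right {q : State prog} {mid : List (PPLetter n)}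
    (h : ∀ a ∈ mid, next prog q (.letter a) = some (q, .right, none))
    (hw : w = pre ++ mid ++ post) :
    Reaches prog w (config prog q (pre.length + 1) out)
      (config prog q (pre.length + mid.length + 1) out) := by
  induction mid generalizing pre with
  | nil => exact reaches_refl
  | cons a mid ih =>
    have h1 : Reaches prog w (config prog q (pre.length + 1) out)
        (config prog q (pre.length + 1 + 1) (out ++ none.toList)) := by
      refine reaches_right (by simp [hw]) ?_
      rw [hw, List.append_assoc, List.cons_append, scan_append]
      exact h a (by simp)
    have h2 := ih (pre := pre ++ [a]) (fun a ha => h a (by simp [ha])) (by simp [hw])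
    simp only [Option.toList_none, List.append_nil, List.length_append, List.length_cons,
      List.length_nil, zero_add] at h1 h2 ⊢
    convert h1.trans h2 using 2
    omega

theorem walk_left {q : State prog} {mid : List (PPLetter n)}
    (h : ∀ a ∈ mid, next prog q (.letter a) = some (q, .left, none))
    (hw : w = pre ++ mid ++ post) :
    Reaches prog w (config prog q (pre.length + mid.length) out)
      (config prog q pre.length out) := by
  induction mid generalizing pre with
  | nil => exact reaches_refl
  | cons a mid ih =>
    have h1 : Reaches prog w (config prog q (pre.length + 1) out)
        (config prog q pre.length (out ++ none.toList)) := by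
      refine reaches_left (by simp [hw]) ?_
      rw [hw, List.append_assoc, List.cons_append, scan_append]
      exact h a (by simp)
    have h2 := ih (pre := pre ++ [a]) (fun a ha => h a (by simp [ha])) (by simp [hw])
    simp only [Option.toList_none, List.append_nil, List.length_append, List.length_cons,
      List.length_nil, zero_add] at h1 h2 ⊢
    convert h2.trans h1 using 2
    omega

/-! ### Running a program on one block -/

/-- Copying stops at the first symbol that is not a digit, hence the condition on `post`. The head
then steps back onto the last letter before that symbol, ready for the return to the block head. -/
theorem reaches_copy {r : Remainder prog} {u : List Bool} (hpost : PPLetter.NoBit post)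
    (hw : w = pre ++ u.map .bit ++ post) :
    Reaches prog w (config prog (pass, .copy, r) (pre.length + 1) out)
      (config prog (pass, .back, r) (pre.length + u.length)
        (out ++ u.flatMap fun b => [.bit false, .bit b])) := by
  induction u generalizing pre out with
  | nil =>
    have h : Reaches prog w (config prog (pass, .copy, r) (pre.length + 1) out)
        (config prog (pass, .back, r) pre.length (out ++ none.toList)) := by
      refine reaches_left (by simp [hw]) ?_
      have h := scan_noBit (pre := pre) hpost
      rw [hw, List.map_nil, List.append_nil]
      generalize Transducer.scan (pre ++ post) (pre.length + 1) = s at h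
      rcases s with _ | _ | (_ | _ | _ | _ | b)
      all_goals first | rfl | exact absurd rfl (h b)
    simpa using h
  | cons b u ih =>
    have hs : Transducer.scan w (pre.length + 1) = .letter (.bit b) := by
      rw [hw, List.append_assoc, List.map_cons, List.cons_append, scan_append]
    have h1 : Reaches prog w (config prog (pass, .copy, r) (pre.length + 1) out)
        (config prog (pass, .copyDigit, r) (pre.length + 1)
          (out ++ (some (.bit false)).toList)) :=
      reaches_stay (by simp [hw]) (by rw [hs]; rfl)
    have h2 : Reaches prog w (config prog (pass, .copyDigit, r) (pre.length + 1)
          (out ++ (some (.bit false)).toList))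
        (config prog (pass, .copy, r) (pre.length + 1 + 1)
          (out ++ (some (.bit false)).toList ++ (some (.bit b)).toList)) :=
      reaches_right (by simp [hw]) (by rw [hs]; rfl)
    have h3 := ih (pre := pre ++ [.bit b])
      (out := out ++ (some (.bit false)).toList ++ (some (.bit b)).toList) (by simp [hw])
    simp only [List.length_append, List.length_cons, List.length_nil, zero_add] at h3
    convert (h1.trans h2).trans h3 using 2
    · simp only [List.length_cons]; omega
    · simp

theorem reaches_next {r : Remainder prog} {l : List (BlockInstr m)} {a : PPLetter n}
    {u : List Bool} (hr : r.1 = .next :: l) (hw : w = pre ++ a :: (u.map .bit ++ .var :: post)) :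
    Reaches prog w (config prog (pass, .run, r) (pre.length + 1) out)
      (config prog (pass, .run, r.pop) (pre.length + 1 + u.length + 1) out) := by
  have h1 : Reaches prog w (config prog (pass, .run, r) (pre.length + 1) out)
      (config prog (pass, .next, r.pop) (pre.length + 1 + 1) (out ++ none.toList)) := by
    refine reaches_right (by simp [hw]) ?_
    simp only [next, hr]
  have h2 := walk_right (w := w) (out := out) (q := (pass, .next, r.pop)) (pre := pre ++ [a])
    (mid := u.map .bit) (post := .var :: post)
    (by simp only [List.mem_map]; rintro _ ⟨b, -, rfl⟩; rfl) (by simp [hw])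
  have h3 : Reaches prog w (config prog (pass, .next, r.pop) (pre.length + 1 + u.length + 1) out)
      (config prog (pass, .run, r.pop) (pre.length + 1 + u.length + 1) (out ++ none.toList)) := by
    refine reaches_stay (by simp [hw]; omega) ?_
    have h := scan_append (pre := pre ++ a :: u.map .bit) (post := post) PPLetter.var
    have hl : (pre ++ a :: u.map PPLetter.bit).length = pre.length + 1 + u.length := by
      simp; omega
    rw [hl] at h
    rw [hw, show pre ++ a :: (u.map PPLetter.bit ++ .var :: post) =
      pre ++ a :: u.map PPLetter.bit ++ .var :: post by simp, h]
    rfl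
  simp only [Option.toList_none, List.append_nil, List.length_append, List.length_cons,
    List.length_nil, List.length_map, zero_add] at h1 h2 h3
  exact (h1.trans h2).trans h3

/-- The digits `u` after the current letter `a` are there for the induction: after one `next`, the
current letter is `var`, followed by the digits of the variable just reached. -/
theorem reaches_nexts {r : Remainder prog} {l : List (BlockInstr m)} {a : PPLetter n}
    {u : List Bool} {args : List ℕ}
    (hr : r.1 = List.replicate (args.length + 1) .next ++ l)
    (hw : w = pre ++ a :: (u.map .bit ++ (args.flatMap encodeVar ++ .var :: post))) :
    ∃ r' : Remainder prog, r'.1 = l ∧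
      Reaches prog w (config prog (pass, .run, r) (pre.length + 1) out)
        (config prog (pass, .run, r')
          (pre.length + 1 + u.length + (args.flatMap (encodeVar (n := n))).length + 1) out) := by
  induction args generalizing r pre a u with
  | nil => exact ⟨r.pop, by simp [Remainder.pop, hr], by
      simpa using reaches_next (by simpa using hr) (by simpa using hw)⟩
  | cons k args ih =>
    have h1 := reaches_next (pass := pass) (out := out) (r := r) (w := w) (pre := pre) (a := a)
      (u := u) (l := List.replicate (args.length + 1) .next ++ l)
      (post := (Nat.bits k).map .bit ++ (args.flatMap encodeVar ++ .var :: post))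
      (by rw [hr, List.length_cons, List.replicate_succ, List.cons_append])
      (by simp [hw, encodeVar])
    obtain ⟨r', hr', h2⟩ := ih (r := r.pop) (pre := pre ++ a :: u.map .bit) (a := .var)
      (u := Nat.bits k) (by simp [Remainder.pop, hr, List.replicate_succ])
      (by simp [hw, encodeVar])
    refine ⟨r', hr', ?_⟩
    have e : (pre ++ a :: u.map PPLetter.bit).length + 1 = pre.length + 1 + u.length + 1 := by
      simp; omega
    rw [e] at h2
    convert h1.trans h2 using 2
    simp [encodeVar]; omega

theorem reaches_copyVar {r : Remainder prog} {l : List (BlockInstr m)} {h : BlockHead n}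
    {args : List ℕ} {p : ℕ} (hp : p < args.length)
    (hr : r.1 = (BlockCommand.copyVar p).compile ++ l) (hpost : PPLetter.NoBit post)
    (hw : w = pre ++ h.letter :: (args.flatMap encodeVar ++ post)) :
    ∃ r' : Remainder prog, r'.1 = l ∧
      Reaches prog w (config prog (pass, .run, r) (pre.length + 1) out)
        (config prog (pass, .run, r') (pre.length + 1)
          (out ++ (BlockCommand.copyVar p).eval args)) := by
  -- Split the variables at the one to be copied. The run then skips `init` (`h1`), enters the
  -- digits of `k` (`h2`), copies them (`h3`), walks back (`h4`) and recognises the block head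
  -- (`h5`).
  obtain ⟨init, k, rest, rfl, rfl⟩ :
      ∃ (init : List ℕ) (k : ℕ) (rest : List ℕ), args = init ++ k :: rest ∧ p = init.length :=
    ⟨args.take p, args[p], args.drop (p + 1), by simp, by simp; omega⟩
  have hpost' : PPLetter.NoBit (rest.flatMap encodeVar ++ post) :=
    noBit_flatMap_encodeVar id rest hpost
  have hw' : w = pre ++ h.letter :: (init.flatMap encodeVar ++ .var ::
      ((Nat.bits k).map .bit ++ (rest.flatMap encodeVar ++ post))) := by
    simp [hw, encodeVar]
  obtain ⟨r₁, hr₁, h1⟩ := reaches_nexts (pass := pass) (out := out) (r := r) (w := w)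
    (pre := pre) (a := h.letter) (u := []) (args := init) (l := .copy :: l)
    (by simpa [BlockCommand.compile] using hr) (by simpa using hw')
  refine ⟨r₁.pop, by simp [Remainder.pop, hr₁], ?_⟩
  have h2 : Reaches prog w
      (config prog (pass, .run, r₁)
        (pre.length + 1 + (init.flatMap (encodeVar (n := n))).length + 1) out)
      (config prog (pass, .copy, r₁.pop)
        (pre.length + 1 + (init.flatMap (encodeVar (n := n))).length + 1 + 1)
        (out ++ none.toList)) := by
    refine reaches_right (by rw [hw']; simp only [List.length_append, List.length_cons]; omega) ?_
    simp only [next, hr₁]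
  have h3 := reaches_copy (pass := pass) (out := out) (r := r₁.pop) (w := w)
    (pre := pre ++ h.letter :: (init.flatMap encodeVar ++ [.var])) (u := Nat.bits k) hpost'
    (by simp [hw'])
  have h4 := walk_left (w := w) (out := out ++ (BlockCommand.copyVar init.length).eval
      (init ++ k :: rest)) (q := (pass, .back, r₁.pop)) (pre := pre ++ [h.letter])
    (mid := (init ++ [k]).flatMap encodeVar) (post := rest.flatMap encodeVar ++ post)
    (fun a ha => by simp only [next, PPLetter.head?_of_mem_encodeVar ha])
    (by simp [hw', encodeVar])
  have h5 : Reaches prog w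
      (config prog (pass, .back, r₁.pop) (pre.length + 1)
        (out ++ (BlockCommand.copyVar init.length).eval (init ++ k :: rest)))
      (config prog (pass, .run, r₁.pop) (pre.length + 1)
        (out ++ (BlockCommand.copyVar init.length).eval (init ++ k :: rest) ++ none.toList)) := by
    refine reaches_stay (by simp [hw]) ?_
    rw [hw, scan_append]
    simp only [next, PPLetter.head?_letter]
  have e : (Nat.bits k).flatMap (fun b => [PPLetter.bit false, PPLetter.bit b]) =
      (BlockCommand.copyVar (m := m) init.length).eval (init ++ k :: rest) := by
    simp [BlockCommand.eval]
  rw [e] at h3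
  simp only [Option.toList_none, List.append_nil, List.length_append, List.length_cons,
    List.length_nil, List.length_map, List.flatMap_append, List.flatMap_cons, List.flatMap_nil,
    encodeVar, zero_add, add_zero] at h1 h2 h3 h4 h5
  refine (h1.trans h2).trans (Reaches.trans ?_ (h4.trans h5))
  convert h3 using 2 <;> omega

theorem reaches_program {r : Remainder prog} {cs : List (BlockCommand m)} {h : BlockHead n}
    {args : List ℕ} (hcs : ∀ c ∈ cs, c.Bounded args.length)
    (hr : r.1 = cs.flatMap BlockCommand.compile) (hpost : PPLetter.NoBit post)
    (hw : w = pre ++ h.letter :: (args.flatMap encodeVar ++ post)) :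
    ∃ r' : Remainder prog, r'.1 = [] ∧
      Reaches prog w (config prog (pass, .run, r) (pre.length + 1) out)
        (config prog (pass, .run, r') (pre.length + 1)
          (out ++ cs.flatMap (BlockCommand.eval args))) := by
  induction cs generalizing r out with
  | nil => exact ⟨r, hr, by simpa using reaches_refl⟩
  | cons c cs ih =>
    rw [List.flatMap_cons] at hr
    obtain ⟨r₁, hr₁, h1⟩ : ∃ r' : Remainder prog, r'.1 = cs.flatMap BlockCommand.compile ∧
        Reaches prog w (config prog (pass, .run, r) (pre.length + 1) out)
          (config prog (pass, .run, r') (pre.length + 1) (out ++ c.eval args)) := by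
      cases c with
      | emit a =>
        refine ⟨r.pop, by simp [Remainder.pop, hr, BlockCommand.compile], ?_⟩
        refine reaches_stay (o := some a) (by simp [hw]) ?_
        rw [hw, scan_append]
        simp only [next, hr, BlockCommand.compile, List.cons_append]
      | copyVar p => exact reaches_copyVar (by exact hcs (.copyVar p) (by simp)) hr hpost hw
    obtain ⟨r₂, hr₂, h2⟩ := ih (out := out ++ c.eval args) (fun c hc => hcs c (by simp [hc])) hr₁
    exact ⟨r₂, hr₂, by simpa using h1.trans h2⟩

/-! ### The two passes over the input -/

variable {ar : Fin n → ℕ}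

theorem noBit_flatMap_word (bs : List (PPBlock ar)) :
    PPLetter.NoBit (bs.flatMap PPBlock.word) := by
  intro b t
  rcases bs with _ | ⟨⟨_ | _ | i, x⟩, bs⟩ <;> simp [PPBlock.word, BlockHead.letter]

/-- The word written in one pass. -/
def passOutput (prog : Bool → BlockHead n → List (BlockCommand m)) (pass : Bool)
    (bs : List (PPBlock ar)) : List (PPLetter m) :=
  bs.flatMap fun b => (prog pass b.head).flatMap (BlockCommand.eval (List.ofFn b.args))

/-- Each program ends on the head of its block, so seeking can resume there and skip the variables.
The leftover program `r'` is irrelevant. -/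
theorem reaches_pass (hprog : ∀ pass h, ∀ c ∈ prog pass h, c.Bounded (h.arity ar))
    {bs : List (PPBlock ar)} {r : Remainder prog} (hw : w = pre ++ bs.flatMap PPBlock.word) :
    ∃ r' : Remainder prog,
      Reaches prog w (config prog (pass, .seek, r) (pre.length + 1) out)
        (config prog (pass, .seek, r') (w.length + 1) (out ++ passOutput prog pass bs)) := by
  induction bs generalizing pre r out with
  | nil => exact ⟨r, by simpa [hw, passOutput] using reaches_refl⟩
  | cons b bs ih =>
    have hw' : w = pre ++ b.head.letter ::
        ((List.ofFn b.args).flatMap encodeVar ++ bs.flatMap PPBlock.word) := by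
      simp [hw, PPBlock.word]
    have h1 : Reaches prog w (config prog (pass, .seek, r) (pre.length + 1) out)
        (config prog (pass, .run, .load prog pass b.head) (pre.length + 1)
          (out ++ none.toList)) := by
      refine reaches_stay (by simp [hw']) ?_
      rw [hw', scan_append]
      simp only [next, PPLetter.head?_letter]
    obtain ⟨r₁, hr₁, h2⟩ := reaches_program (pass := pass) (out := out) (args := List.ofFn b.args)
      (r := .load prog pass b.head) (cs := prog pass b.head)
      (by simpa using hprog pass b.head) rfl (noBit_flatMap_word bs) hw'
    have h3 : Reaches prog w
        (config prog (pass, .run, r₁) (pre.length + 1)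
          (out ++ (prog pass b.head).flatMap (BlockCommand.eval (List.ofFn b.args))))
        (config prog (pass, .seek, r₁) (pre.length + 1 + 1)
          (out ++ (prog pass b.head).flatMap (BlockCommand.eval (List.ofFn b.args)) ++
            none.toList)) := by
      refine reaches_right (by simp [hw']) ?_
      simp only [next, hr₁]
    have h4 := walk_right (w := w) (q := (pass, .seek, r₁)) (pre := pre ++ [b.head.letter])
      (out := out ++ (prog pass b.head).flatMap (BlockCommand.eval (List.ofFn b.args)))
      (mid := (List.ofFn b.args).flatMap encodeVar) (post := bs.flatMap PPBlock.word)
      (fun a ha => by simp only [next, PPLetter.head?_of_mem_encodeVar ha]) (by simp [hw'])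
    obtain ⟨r₂, h5⟩ := ih (r := r₁) (pre := pre ++ b.word)
      (out := out ++ (prog pass b.head).flatMap (BlockCommand.eval (List.ofFn b.args)))
      (by simp [hw])
    refine ⟨r₂, ?_⟩
    have e : (pre ++ b.word).length + 1 = (pre ++ [b.head.letter]).length +
        ((List.ofFn b.args).flatMap (encodeVar (n := n))).length + 1 := by
      simp only [PPBlock.word, List.length_append, List.length_cons, List.length_nil]
      omega
    rw [e] at h5
    simp only [Option.toList_none, List.append_nil] at h1 h3
    have h6 := (h1.trans h2).trans (h3.trans (Reaches.trans (cast (by simp) h4) h5))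
    simpa [passOutput] using h6

theorem haltsWith (hprog : ∀ pass h, ∀ c ∈ prog pass h, c.Bounded (h.arity ar))
    (bs : List (PPBlock ar)) :
    (machine prog).HaltsWith (bs.flatMap PPBlock.word)
      (passOutput prog false bs ++ passOutput prog true bs) := by
  generalize hw : bs.flatMap PPBlock.word = w
  have h1 : Reaches prog w (machine prog).init
      (config prog (false, .seek, .load prog false .ex) 1 ([] ++ none.toList)) := by
    rw [init_eq]
    exact reaches_right (Nat.zero_le _) rfl
  obtain ⟨r₁, h2⟩ := reaches_pass (pre := []) (pass := false) (out := []) hprog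
    (r := .load prog false .ex) (bs := bs) (by simpa using hw.symm)
  have h3 : Reaches prog w
      (config prog (false, .seek, r₁) (w.length + 1) ([] ++ passOutput prog false bs))
      (config prog (false, .rewind, r₁) w.length
        ([] ++ passOutput prog false bs ++ none.toList)) :=
    reaches_left le_rfl (by rw [scan_end]; rfl)
  have h4 := walk_left (w := w) (q := (false, .rewind, r₁)) (pre := []) (post := []) (mid := w)
    (out := passOutput prog false bs) (fun a _ => rfl) (by simp)
  have h5 : Reaches prog w
      (config prog (false, .rewind, r₁) 0 (passOutput prog false bs))
      (config prog (true, .seek, r₁) 1 (passOutput prog false bs ++ none.toList)) :=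
    reaches_right (Nat.zero_le _) rfl
  obtain ⟨r₂, h6⟩ := reaches_pass (pre := []) (pass := true) (out := passOutput prog false bs)
    hprog (r := r₁) (bs := bs) (by simpa using hw.symm)
  simp only [Option.toList_none, List.append_nil, List.nil_append, List.length_nil,
    zero_add] at h1 h2 h3 h4 h5 h6
  refine ⟨_, (h1.trans h2).trans ((h3.trans h4).trans (h5.trans h6)), ?_, rfl⟩
  simp only [Transducer.step, config, machine, scan_end]
  rfl

end BlockTransducer

/-! ### The reduction -/

namespace CSPReduction

open BlockHead

variable (A B : FinRelStr)

attribute [local instance] FinRelStr.finite_dom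

/-- A cell in the table of an operation on `A` whose arguments are indexed by the tuples in the
constraint of a block head. -/
abbrev Cell : Type _ := Σ h : BlockHead B.numRel, (h.constraint B → A.Dom)

/-- A numbering of the cells. -/
noncomputable def Cell.index (c : Cell A B) : ℕ := Finite.equivFin (Cell A B) c

variable {A B} in
theorem Cell.index_injective : Function.Injective (Cell.index A B) := fun _ _ h =>
  (Finite.equivFin (Cell A B)).injective (Fin.val_injective h)

/-- The elements of a finite type, as a list. -/
noncomputable def elements (α : Type*) [Finite α] : List α :=
  (Set.toFinite (Set.univ : Set α)).toFinset.toList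

theorem mem_elements {α : Type*} [Finite α] (a : α) : a ∈ elements α := by
  simp [elements]

/-- The polymorphism constraints on an operation whose arguments are indexed by the tuples in the
constraint of `h`: a relation of `A`, and a tuple in this relation for each argument. -/
abbrev PolConstraint (h : BlockHead B.numRel) : Type _ :=
  Σ j : Fin A.numRel, (h.constraint B → A.rel j)

/-- The minor equations between the operation of a block with head `h` and those of its variables:
a position in the block, and an argument of the operation of the variable there. -/
abbrev MinorEquation (h : BlockHead B.numRel) : Type _ :=
  Fin (h.arity B.arity) × (B.Dom → A.Dom)

variable {A B}

/-- The row of the polymorphism constraint at a position of the relation. -/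
def PolConstraint.row {h : BlockHead B.numRel} (r : PolConstraint A B h)
    (q : Fin (A.arity r.1)) : h.constraint B → A.Dom :=
  fun t => (r.2 t).1 q

/-- The argument on the left-hand side of a minor equation. -/
def MinorEquation.lhs {h : BlockHead B.numRel} (e : MinorEquation A B h) :
    h.constraint B → A.Dom :=
  fun t => e.2 (t.1 e.1)

/-- The argument of the operation of a variable given by a function on `B`. -/
def varArg (u : B.Dom → A.Dom) : (ex : BlockHead B.numRel).constraint B → A.Dom :=
  fun t => u (t.1 (0 : Fin 1))

/-! ### Programs writing the new variables and atoms -/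

/-- Commands writing the variable named by the cell `c` and the variables at positions `ps`. -/
noncomputable def writeName (c : Cell A B) (ps : List ℕ) : List (BlockCommand A.numRel) :=
  .emit .var :: (List.replicate c.index (.emit (.bit false)) ++ .emit (.bit true) ::
    ps.flatMap fun p => [.copyVar p, .emit (.bit true)])

/-- This is what the shape of `nameBits` is for: the tag is a constant of the program, and `copyVar`
followed by the digit `1` writes exactly one `delimitedBits` code. -/
theorem eval_writeName (c : Cell A B) (ps l : List ℕ) :
    (writeName c ps).flatMap (BlockCommand.eval l) =
      encodeVar (name c.index (ps.map fun p => l.getD p 0)) := by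
  have h1 : ∀ k, (List.replicate k (BlockCommand.emit (.bit false))).flatMap
      (BlockCommand.eval l) = List.replicate k (PPLetter.bit (n := A.numRel) false) := by
    intro k
    induction k with
    | zero => rfl
    | succ k ih => simp [List.replicate_succ, ih, BlockCommand.eval]
  have h2 : ∀ m, (delimitedBits m).map (PPLetter.bit (n := A.numRel)) =
      (Nat.bits m).flatMap (fun b => [.bit false, .bit b]) ++ [.bit true] := by
    intro m
    simp [delimitedBits, List.map_flatMap]
  simp [writeName, encodeVar, bits_name, nameBits, h1, BlockCommand.eval, List.flatMap_assoc,
    List.map_flatMap, List.flatMap_map, h2]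

theorem bounded_writeName {c : Cell A B} {ps : List ℕ} {k : ℕ} (h : ∀ p ∈ ps, p < k) :
    ∀ x ∈ writeName c ps, x.Bounded k := by
  intro x hx
  simp only [writeName, List.mem_cons, List.mem_append, List.mem_replicate, List.mem_flatMap,
    List.not_mem_nil, or_false] at hx
  rcases hx with rfl | ⟨-, rfl⟩ | rfl | ⟨p, hp, rfl | rfl⟩
  exacts [trivial, trivial, trivial, h p hp, trivial]

/-- The positions of the variables in a block. -/
def positions (h : BlockHead B.numRel) : List ℕ := List.range (h.arity B.arity)

/-- Commands quantifying the table of the operation of a block. -/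
noncomputable def quantifierProgram (h : BlockHead B.numRel) : List (BlockCommand A.numRel) :=
  (elements (h.constraint B → A.Dom)).flatMap fun s =>
    .emit .ex :: writeName ⟨h, s⟩ (positions h)

/-- Commands writing the polymorphism constraints and the minor equations of a block. -/
noncomputable def atomProgram (h : BlockHead B.numRel) : List (BlockCommand A.numRel) :=
  ((elements (PolConstraint A B h)).flatMap fun r =>
    .emit (.rel r.1) :: (List.ofFn r.row).flatMap fun s => writeName ⟨h, s⟩ (positions h)) ++
  (elements (MinorEquation A B h)).flatMap fun e =>
    .emit .eq :: (writeName ⟨h, e.lhs⟩ (positions h) ++ writeName ⟨.ex, varArg e.2⟩ [e.1.1])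

/-- The program of the reduction. -/
noncomputable def program (A B : FinRelStr) (pass : Bool) (h : BlockHead B.numRel) :
    List (BlockCommand A.numRel) :=
  if pass then atomProgram h else quantifierProgram h

theorem bounded_program (pass : Bool) (h : BlockHead B.numRel) :
    ∀ c ∈ program A B pass h, c.Bounded (h.arity B.arity) := by
  have hpos : ∀ c : Cell A B, ∀ x ∈ writeName c (positions h), x.Bounded (h.arity B.arity) :=
    fun c => bounded_writeName fun p hp => List.mem_range.1 hp
  intro x hx
  cases pass with
  | false =>
    simp only [program, quantifierProgram, Bool.false_eq_true, if_false, List.mem_flatMap,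
      List.mem_cons] at hx
    obtain ⟨s, -, rfl | hx⟩ := hx
    exacts [trivial, hpos _ x hx]
  | true =>
    simp only [program, atomProgram, if_true, List.mem_append, List.mem_flatMap,
      List.mem_cons] at hx
    rcases hx with ⟨r, -, rfl | ⟨c, -, hx⟩⟩ | ⟨e, -, rfl | hx | hx⟩
    · trivial
    · exact hpos _ x hx
    · trivial
    · exact hpos _ x hx
    · exact bounded_writeName (by simp) x hx

/-- The name of a cell in the table of the operation of a block. -/
noncomputable def cellName (c : Cell A B) (b : PPBlock B.arity) : ℕ :=
  name c.index (List.ofFn b.args)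

theorem cellName_inj {b b' : PPBlock B.arity} {s : b.head.constraint B → A.Dom}
    {s' : b'.head.constraint B → A.Dom} (h : cellName ⟨b.head, s⟩ b = cellName ⟨b'.head, s'⟩ b') :
    b = b' ∧ HEq s s' := by
  obtain ⟨h1, h2⟩ := name_inj h
  have h3 := Cell.index_injective h1
  obtain ⟨i, x⟩ := b
  obtain ⟨j, y⟩ := b'
  obtain ⟨h4, h5⟩ := Sigma.mk.inj h3
  subst h4
  cases List.ofFn_injective h2
  exact ⟨rfl, h5⟩

theorem eval_writeName_positions (c : Cell A B) (b : PPBlock B.arity) :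
    (writeName c (positions b.head)).flatMap (BlockCommand.eval (List.ofFn b.args)) =
      encodeVar (cellName c b) := by
  rw [eval_writeName, cellName]
  congr 2
  refine List.ext_getElem (by simp [positions]) fun i h1 h2 => ?_
  have h3 : i < b.head.arity B.arity := by simpa [positions] using h1
  simp [positions, h3]

/-- A block can refer to the table of one of its variables without visiting the quantifier block,
because names there depend only on the number of the variable and the cell. -/
theorem eval_writeName_var (u : B.Dom → A.Dom) (b : PPBlock B.arity)
    (p : Fin (b.head.arity B.arity)) :
    (writeName (⟨.ex, varArg u⟩ : Cell A B) [p.1]).flatMap (BlockCommand.eval (List.ofFn b.args)) =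
      encodeVar (cellName (⟨.ex, varArg u⟩ : Cell A B) (.quantifier (b.args p))) := by
  rw [eval_writeName, cellName]
  congr 2
  have h : (List.ofFn b.args)[p.1]? = some (b.args p) := by
    rw [List.getElem?_ofFn, dif_pos p.2]
  simpa [PPBlock.quantifier, BlockHead.arity] using congrArg (Option.getD · 0) h

/-! ### The sentence over `A` and its truth -/

variable (A) (φ : PPSentence B.arity)

/-- The variables of the sentence produced by the reduction. -/
noncomputable def cellVars : List ℕ :=
  φ.blocks.flatMap fun b =>
    (elements (b.head.constraint B → A.Dom)).map fun s => cellName ⟨b.head, s⟩ b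

variable {A φ}

theorem cellName_mem {b : PPBlock B.arity} (hb : b ∈ φ.blocks)
    (s : b.head.constraint B → A.Dom) : cellName ⟨b.head, s⟩ b ∈ cellVars A φ :=
  List.mem_flatMap.2 ⟨b, hb, List.mem_map_of_mem (mem_elements s)⟩

/-- The variable for a cell in the table of the operation of a block. -/
noncomputable def cellVar (b : {b // b ∈ φ.blocks}) (s : b.1.head.constraint B → A.Dom) :
    {m // m ∈ cellVars A φ} :=
  ⟨cellName ⟨b.1.head, s⟩ b.1, cellName_mem b.2 s⟩

/-- The block quantifying the variable at a position of a block. -/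
def argBlock (b : {b // b ∈ φ.blocks}) (p : Fin (b.1.head.arity B.arity)) :
    {b // b ∈ φ.blocks} :=
  ⟨.quantifier (b.1.args p), PPSentence.quantifier_mem_blocks (PPSentence.args_mem_vars b.2 p)⟩

variable (A φ)

/-- The sentence produced by the reduction: there are polymorphisms of `A`, one for each block of
`φ`, satisfying the minor equations. -/
noncomputable def minorSentence : PPSentence A.arity where
  vars := cellVars A φ
  atoms := φ.blocks.attach.flatMap fun b =>
    ((elements (PolConstraint A B b.1.head)).map fun r =>
      .rel r.1 fun q => cellVar b (r.row q)) ++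
    (elements (MinorEquation A B b.1.head)).map fun e =>
      .eq (cellVar b e.lhs) (cellVar (argBlock b e.1) (varArg e.2))

theorem encode_minorSentence :
    (minorSentence A φ).encode =
      BlockTransducer.passOutput (program A B) false φ.blocks ++
        BlockTransducer.passOutput (program A B) true φ.blocks := by
  unfold PPSentence.encode BlockTransducer.passOutput
  congr 1
  · simp only [minorSentence, cellVars, program, quantifierProgram, List.flatMap_assoc,
      List.flatMap_map, List.flatMap_cons, eval_writeName_positions, BlockCommand.eval,
      Bool.false_eq_true, if_false]
    rfl
  -- The atoms are listed along blocks with membership proofs, needed for `argBlock`; the machine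
  -- reads the plain list.
  · conv_rhs => rw [← List.attach_map_subtype_val φ.blocks, List.flatMap_map]
    simp only [minorSentence, List.flatMap_assoc, program, if_true]
    refine congrArg (List.flatMap · _) (funext fun b => ?_)
    simp only [atomProgram, List.flatMap_append, List.flatMap_assoc, List.flatMap_map,
      List.flatMap_cons, eval_writeName_positions, eval_writeName_var, BlockCommand.eval,
      PPAtom.encode]
    congr 1
    refine congrArg (List.flatMap · _) (funext fun r => ?_)
    rw [List.singleton_append, List.flatMap_def, List.flatMap_def, List.map_ofFn, List.map_ofFn]
    rfl

theorem haltsWith :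
    (BlockTransducer.machine (program A B)).HaltsWith φ.encode (minorSentence A φ).encode := by
  rw [φ.encode_eq_flatMap_blocks, encode_minorSentence]
  exact BlockTransducer.haltsWith bounded_program _

variable {A φ}

/-- Assignments correspond to families of tables because names determine both the block and the
cell. Repeated blocks share a table, as `g` is indexed by the set of blocks. -/
theorem minorSentence_trueIn_iff :
    (minorSentence A φ).TrueIn A ↔
      ∃ g : ∀ b : {b // b ∈ φ.blocks}, (b.1.head.constraint B → A.Dom) → A.Dom,
        (∀ b (r : PolConstraint A B b.1.head), (fun q => g b (r.row q)) ∈ A.rel r.1) ∧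
        ∀ b (e : MinorEquation A B b.1.head),
          g b e.lhs = g (argBlock b e.1) (varArg e.2) := by
  have key : ∀ g : {m // m ∈ cellVars A φ} → A.Dom,
      (∀ a ∈ (minorSentence A φ).atoms, a.Holds A g) ↔
        (∀ b (r : PolConstraint A B b.1.head),
          (fun q => g (cellVar b (r.row q))) ∈ A.rel r.1) ∧
        ∀ b (e : MinorEquation A B b.1.head),
          g (cellVar b e.lhs) = g (cellVar (argBlock b e.1) (varArg e.2)) := by
    intro g
    constructor
    · intro h
      constructor
      · exact fun b r => h _ (List.mem_flatMap.2 ⟨b, List.mem_attach _ _,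
          List.mem_append_left _ (List.mem_map_of_mem (mem_elements r))⟩)
      · exact fun b e => h _ (List.mem_flatMap.2 ⟨b, List.mem_attach _ _,
          List.mem_append_right _ (List.mem_map_of_mem (mem_elements e))⟩)
    · rintro ⟨h1, h2⟩ a ha
      obtain ⟨b, -, ha⟩ := List.mem_flatMap.1 ha
      rcases List.mem_append.1 ha with ha | ha
      · obtain ⟨r, -, rfl⟩ := List.mem_map.1 ha
        exact h1 b r
      · obtain ⟨e, -, rfl⟩ := List.mem_map.1 ha
        exact h2 b e
  constructor
  · rintro ⟨g, hg⟩
    exact ⟨fun b s => g (cellVar b s), (key g).1 hg⟩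
  · rintro ⟨g, hg⟩
    have hsurj : ∀ x : {m // m ∈ cellVars A φ},
        ∃ (b : {b // b ∈ φ.blocks}) (s : b.1.head.constraint B → A.Dom), cellVar b s = x := by
      rintro ⟨m, hm⟩
      obtain ⟨b, hb, hm⟩ := List.mem_flatMap.1 hm
      obtain ⟨s, -, rfl⟩ := List.mem_map.1 hm
      exact ⟨⟨b, hb⟩, s, rfl⟩
    choose b s hbs using hsurj
    have hinj : ∀ (b c : {b // b ∈ φ.blocks}) (s : b.1.head.constraint B → A.Dom)
        (t : c.1.head.constraint B → A.Dom), cellVar b s = cellVar c t → g b s = g c t := by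
      rintro ⟨b, hb⟩ ⟨c, hc⟩ s t h
      obtain ⟨h1, h2⟩ := cellName_inj (b := b) (b' := c) (congrArg Subtype.val h)
      subst h1
      cases h2
      rfl
    have hval : ∀ (c : {b // b ∈ φ.blocks}) (t : c.1.head.constraint B → A.Dom),
        g (b (cellVar c t)) (s (cellVar c t)) = g c t :=
      fun c t => hinj _ _ _ _ (hbs (cellVar c t))
    refine ⟨fun x => g (b x) (s x), (key _).2 ?_⟩
    exact ⟨fun c r => by simpa only [hval] using hg.1 c r,
      fun c e => (hval _ _).trans ((hg.2 c e).trans (hval _ _).symm)⟩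

/-- A satisfying assignment of `φ` gives projections satisfying the minor equations. -/
theorem minorSentence_trueIn (h : φ.TrueIn B) : (minorSentence A φ).TrueIn A := by
  obtain ⟨g, hg⟩ := h
  let val (b : {b // b ∈ φ.blocks}) (p : Fin (b.1.head.arity B.arity)) : B.Dom :=
    g ⟨b.1.args p, PPSentence.args_mem_vars b.2 p⟩
  have hval : ∀ b, val b ∈ b.1.head.constraint B := by
    rintro ⟨b, hb⟩
    rcases List.mem_append.1 hb with h | h
    · obtain ⟨m, -, rfl⟩ := List.mem_map.1 h
      exact Set.mem_univ _
    · obtain ⟨a, ha, rfl⟩ := List.mem_map.1 h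
      have := hg a ha
      cases a with
      | rel i x => exact this
      | eq x y => exact this
  -- Projections preserve every relation, and both sides of a minor equation evaluate to `e.2` at
  -- the value of the variable.
  exact minorSentence_trueIn_iff.2 ⟨fun b s => s ⟨val b, hval b⟩,
    fun b r => (r.2 ⟨val b, hval b⟩).2, fun b e => rfl⟩

/-! ### The minor equations as a strong Maltsev condition -/

variable (φ)

/-- The number of tuples in the constraint of a block. -/
noncomputable def opArity (b : PPBlock B.arity) : ℕ := Nat.card (b.head.constraint B)

/-- The tuples in the constraint of a block, numbered. -/
noncomputable def tupleEquiv (b : PPBlock B.arity) :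
    b.head.constraint B ≃ Fin (opArity b) := Finite.equivFin _

/-- One operation symbol for each block of `φ`, with an argument for each tuple in its
constraint. -/
def minorLang : FirstOrder.Language.{0, 0} where
  Functions k := {b : {b // b ∈ φ.blocks} // opArity b.1 = k}
  Relations _ := Empty

instance : (minorLang φ).IsAlgebraic := fun _ => inferInstanceAs (IsEmpty Empty)

variable {φ} in
/-- The operation symbol of a block, applied to variables indexed by the elements of `B`. -/
noncomputable def minorTerm (b : {b // b ∈ φ.blocks}) (x : b.1.head.constraint B → B.Dom) :
    (minorLang φ).Term ℕ :=
  .func (⟨b, rfl⟩ : (minorLang φ).Functions (opArity b.1)) fun i =>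
    .var (Finite.equivFin B.Dom (x ((tupleEquiv b.1).symm i)))

open Classical in
/-- The minor equations as a strong Maltsev condition. -/
noncomputable def minorCondition : StrongMaltsevCondition where
  lang := minorLang φ
  eqs := (φ.blocks.attach.flatMap fun b => (List.ofFn fun p => (minorTerm b fun t => t.1 p,
    minorTerm (argBlock b p) fun t => t.1 (0 : Fin 1)))).toFinset

theorem mem_minorCondition_eqs {e : (minorLang φ).Term ℕ × (minorLang φ).Term ℕ} :
    e ∈ (minorCondition φ).eqs ↔ ∃ b p, (minorTerm b fun t => t.1 p,
      minorTerm (argBlock b p) fun t => t.1 (0 : Fin 1)) = e := by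
  classical
  refine List.mem_toFinset.trans (List.mem_flatMap.trans ?_)
  simp only [List.mem_attach, true_and, List.mem_ofFn]

/-- Renumbering arguments by `tupleEquiv` turns operations with numbered arguments into tables
indexed by tuples. The domain `D` is arbitrary since the result is needed for both `A` and `B`. -/
theorem minorCondition_satisfiedIn_iff (D : FinRelStr) :
    (minorCondition φ).SatisfiedIn (Pol D) ↔
      ∃ g : ∀ b : {b // b ∈ φ.blocks}, (b.1.head.constraint B → D.Dom) → D.Dom,
        (∀ b (r : PolConstraint D B b.1.head), (fun q => g b (r.row q)) ∈ D.rel r.1) ∧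
        ∀ b (p : Fin (b.1.head.arity B.arity)) (v : ℕ → D.Dom),
          g b (fun t => v (Finite.equivFin B.Dom (t.1 p))) =
            g (argBlock b p) (fun t => v (Finite.equivFin B.Dom (t.1 (0 : Fin 1)))) := by
  constructor
  · rintro ⟨I, hI, heq⟩
    refine ⟨fun b s => I.funMap (⟨b, rfl⟩ : (minorLang φ).Functions (opArity b.1))
      fun i => s ((tupleEquiv b.1).symm i), fun b r => ?_, fun b p v => ?_⟩
    · exact hI _ (⟨b, rfl⟩ : (minorLang φ).Functions (opArity b.1)) r.1
        (fun i => (r.2 ((tupleEquiv b.1).symm i)).1) fun i => (r.2 ((tupleEquiv b.1).symm i)).2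
    · refine heq (minorTerm b fun t => t.1 p, minorTerm (argBlock b p) fun t => t.1 (0 : Fin 1))
        ?_ v
      exact (mem_minorCondition_eqs φ).2 ⟨b, p, rfl⟩
  · rintro ⟨g, h1, h2⟩
    let I : (minorLang φ).Structure D.Dom :=
      { funMap := fun f x => g f.1 fun t => x (Fin.cast f.2 (tupleEquiv f.1.1 t))
        RelMap := fun r _ => r.elim }
    have hterm : ∀ (b : {b // b ∈ φ.blocks}) (x : b.1.head.constraint B → B.Dom) (v : ℕ → D.Dom),
        (minorTerm b x).realize v = g b fun t => v (Finite.equivFin B.Dom (x t)) := by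
      intro b x v
      change g b (fun t => v (Finite.equivFin B.Dom
        (x ((tupleEquiv b.1).symm (tupleEquiv b.1 t))))) = _
      simp only [Equiv.symm_apply_apply]
    refine ⟨I, ?_, ?_⟩
    · rintro k ⟨b, rfl⟩ j r hr
      exact h1 b ⟨j, fun t => ⟨r (tupleEquiv b.1 t), hr _⟩⟩
    · intro e he v
      obtain ⟨b, p, rfl⟩ := (mem_minorCondition_eqs φ).1 he
      exact (hterm _ _ v).trans ((h2 b p v).trans (hterm _ _ v).symm)

theorem trueIn_of_minorSentence_trueIn
    (hAB : ∀ S : StrongMaltsevCondition, S.SatisfiedIn (Pol A) → S.SatisfiedIn (Pol B))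
    (h : (minorSentence A φ).TrueIn A) : φ.TrueIn B := by
  have h' : (minorCondition φ).SatisfiedIn (Pol A) := by
    obtain ⟨g, h1, h2⟩ := minorSentence_trueIn_iff.1 h
    exact (minorCondition_satisfiedIn_iff φ A).2 ⟨g, h1, fun b p v =>
      h2 b (p, fun x => v (Finite.equivFin B.Dom x))⟩
  obtain ⟨g, h1, h2⟩ := (minorCondition_satisfiedIn_iff φ B).1 (hAB _ h')
  let val (m : {m // m ∈ φ.vars}) : B.Dom :=
    g ⟨.quantifier m.1, PPSentence.quantifier_mem_blocks m.2⟩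
      fun t => t.1 (0 : Fin 1)
  have hval : ∀ (b : {b // b ∈ φ.blocks}) (p : Fin (b.1.head.arity B.arity)),
      g b (fun t => t.1 p) = val ⟨b.1.args p, PPSentence.args_mem_vars b.2 p⟩ := by
    intro b p
    -- Taking `v = id` requires a left inverse of the numbering of `B`, defined on all of `ℕ`; the
    -- value of `g` supplies the element needed for it.
    have : Nonempty B.Dom := ⟨g b fun t => t.1 p⟩
    have hv : ∀ x, Function.invFun (fun x => (Finite.equivFin B.Dom x).1)
        (Finite.equivFin B.Dom x).1 = x :=
      Function.leftInverse_invFun (f := fun x => (Finite.equivFin B.Dom x).1)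
        (Fin.val_injective.comp (Finite.equivFin B.Dom).injective)
    have := h2 b p (Function.invFun fun x => (Finite.equivFin B.Dom x).1)
    simp only [hv] at this
    exact this
  refine ⟨val, fun a ha => ?_⟩
  have hb : PPBlock.ofAtom a ∈ φ.blocks := List.mem_append_right _ (List.mem_map_of_mem ha)
  cases a with
  | rel i x =>
    -- With `id`, the operation is applied to the list of all tuples of the relation. If the
    -- relation is empty, the operation is nullary and its preservation is already contradictory.
    exact (congrArg (· ∈ B.rel i) (funext fun q => hval ⟨_, hb⟩ q)).mp (h1 ⟨_, hb⟩ ⟨i, id⟩)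
  | eq x y =>
    have e0 := hval ⟨_, hb⟩ (0 : Fin 2)
    have e1 := hval ⟨_, hb⟩ (1 : Fin 2)
    refine (e0.symm.trans ?_).trans e1
    -- All tuples in an equality constraint have equal entries, so both positions give the operation
    -- the same argument.
    exact congrArg (g ⟨_, hb⟩) (funext fun t => t.2)

end CSPReduction

theorem logSpaceReducible_of_maltsev {A B : FinRelStr}
    (hAB : ∀ S : StrongMaltsevCondition, S.SatisfiedIn (Pol A) → S.SatisfiedIn (Pol B)) :
    LogSpaceReducible (CSP B) (CSP A) := by
  refine ⟨CSPReduction.minorSentence A,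
    -- The space constant can be `0` because there are no work tapes.
    ⟨BlockTransducer.machine (CSPReduction.program A B), 0, fun φ => ⟨?_, fun _ _ i => i.elim0⟩⟩,
    fun φ => ⟨CSPReduction.minorSentence_trueIn,
      CSPReduction.trueIn_of_minorSentence_trueIn φ hAB⟩⟩
  exact CSPReduction.haltsWith A φ

theorem theorem2 (A B : FinRelStr) :
    ((∀ S : StrongMaltsevCondition, S.SatisfiedIn (Pol A) → S.SatisfiedIn (Pol B)) →
      LogSpaceReducible (CSP B) (CSP A)) ∧
    ((∀ S : StrongMaltsevCondition, S.SatisfiedIn (Pol A) ↔ S.SatisfiedIn (Pol B)) →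
      LogSpaceReducible (CSP A) (CSP B) ∧ LogSpaceReducible (CSP B) (CSP A)) :=
  ⟨logSpaceReducible_of_maltsev, fun h =>
    ⟨logSpaceReducible_of_maltsev fun S => (h S).2,
      logSpaceReducible_of_maltsev fun S => (h S).1⟩⟩
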